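/- **Conventions.** $\mathbb R^d$ ($d\in\mathbb N$) carries its Euclidean structure, Borel $\sigma$-field and Lebesgue measure $\lambda$. The definitions of conservative field and potential below are used on every Euclidean space $\mathbb R^m$, $m\ge 0$. *Conservative fields.* A set-valued map $D:\mathbb R^m\rightrightarrows\mathbb R^m$ is a *conservative field* if each $D(x)$ is nonempty and compact, the graph $\{(x,v):v\in D(x)\}$ is closed, and for every absolutely continuous $a:[0,1]\to\mathbb R^m$ with $a(0)=a(1)$ the functions $t\mapsto\min_{v\in D(a(t))}\langle\dot a(t),v\rangle$ and $t\mapsto\max_{v\in D(a(t))}\langle\dot a(t),v\rangle$ are Lebesgue integrable on $[0,1]$ and $$\int_0^1\min_{v\in D(a(t))}\langle\dot a(t),v\rangle\,dt=\int_0^1\max_{v\in D(a(t))}\langle\dot a(t),v\rangle\,dt=0 .$$ A function $F:\mathbb R^m\to\mathbb R$ is a *potential* of the conservative field $D$ if for every $x$ and every absolutely continuous $a:[0,1]\to\mathbb R^m$ with $a(0)=0$, $a(1)=x$, $$F(x)=F(0)+\int_0^1\min_{v\in D(a(t))}\langle\dot a(t),v\rangle\,dt .$$ A function that is a potential of some conservative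 field is called *path differentiable*. *A.e.-gradients.* Let $(\Xi,\mathscr T,\mu)$ be a probability space and $f:\mathbb R^d\times\Xi\to\mathbb R$. A function $\varphi:\mathbb R^d\times\Xi\to\mathbb R^d$ is an *a.e.-gradient* of $f$ if $f(\cdot,s)$ is locally Lipschitz for every $s\in\Xi$ and, for $\lambda\otimes\mu$-almost every $(x,s)$, $f(\cdot,s)$ is differentiable at $x$ with gradient $\varphi(x,s)$. *Automatic differentiation.* A computation graph with $d$ inputs has vertices $1,\dots,q$ with $q>d$, and for each $i>d$ a set $\mathrm{pa}(i)\subset\{1,\dots,i-1\}$ and a function $g_i:\mathbb R^{\mathrm{pa}(i)}\to\mathbb R$. On input $x=(x_1,\dots,x_d)$ put $x_i=g_i((x_j)_{j\in\mathrm{pa}(i)})$ for $i>d$; the graph represents the function $x\mapsto x_q$. Let each $g_i$ ($i>d$) be path differentiable and let $\delta_i:\mathbb R^{\mathrm{pa}(i)}\to\mathbb R^{\mathrm{pa}(i)}$ satisfy $\delta_i(z)\in D_i(z)$ for all $z$, where $D_i$ is some conservative field with potential $g_i$. The *autograd output* at $x$ is $(w_1,\dots,w_d)$, where $w_q,\dots,w_1$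 are computed by backpropagation, $$w_i=\mathbf 1_{i=q}+\sum_{k>d\,:\,i\in\mathrm{pa}(k)}w_k\,\big[\delta_k\big((x_j)_{j\in\mathrm{pa}(k)}\big)\big]_i .$$ **Proposition.** Let $(\Xi,\mathscr T,\mu)$ be a probability space. 1. Let $f:\mathbb R^d\times\Xi\to\mathbb R$ be such that for every $s\in\Xi$ the function $f(\cdot,s)$ is a potential of a conservative field $D_s$ (so $f(\cdot,s)$ is path differentiable). Let $\varphi:\mathbb R^d\times\Xi\to\mathbb R^d$ be $\mathscr B(\mathbb R^d)\otimes\mathscr T$-measurable with $\varphi(x,s)\in D_s(x)$ for all $(x,s)$. Then $\varphi$ is an a.e.-gradient of $f$. 2. For every $s\in\Xi$ let $f(\cdot,s):\mathbb R^d\to\mathbb R$ be represented by a computation graph (depending on $s$) of path differentiable functions, with derivative selections $\delta_i$ as above, and let $a(x,s)$ be the corresponding autograd output at $x$. If $\Xi$ is countable (for instance $\Xi=\mathbb N$), or if $(x,s)\mapsto a(x,s)$ is $\mathscr B(\mathbb R^d)\otimes\mathscr T$-measurable, then $a$ is an a.e.-gradient of $f$. -/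

import Mathlib

open MeasureTheory

noncomputable section

section Conservative

variable {E : Type*} [NormedAddCommGroup E] [InnerProductSpace ℝ E]

/-- `min_{v ∈ D (a t)} ⟪ȧ(t), v⟫`; the minimum is attained when `D (a t)` is nonempty compact. -/
def minAlong (D : E → Set E) (a : ℝ → E) (t : ℝ) : ℝ :=
  sInf ((fun v => inner ℝ (deriv a t) v) '' D (a t))

/-- `max_{v ∈ D (a t)} ⟪ȧ(t), v⟫`; the maximum is attained when `D (a t)` is nonempty compact. -/
def maxAlong (D : E → Set E) (a : ℝ → E) (t : ℝ) : ℝ :=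
  sSup ((fun v => inner ℝ (deriv a t) v) '' D (a t))

/-- Conservative fields: nonempty compact values, closed graph, and along every absolutely
continuous loop `a : [0, 1] → E` both circulation integrals exist and vanish. Curves are functions
on `ℝ` of which only the restriction to `[0, 1]` matters. -/
structure IsConservativeField (D : E → Set E) : Prop where
  nonempty : ∀ x, (D x).Nonempty
  isCompact : ∀ x, IsCompact (D x)
  isClosed_graph : IsClosed {p : E × E | p.2 ∈ D p.1}
  loop_min : ∀ a : ℝ → E, AbsolutelyContinuousOnInterval a 0 1 → a 0 = a 1 →
    IntervalIntegrable (minAlong D a) volume 0 1 ∧ ∫ t in (0 : ℝ)..1, minAlong D a t = 0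
  loop_max : ∀ a : ℝ → E, AbsolutelyContinuousOnInterval a 0 1 → a 0 = a 1 →
    IntervalIntegrable (maxAlong D a) volume 0 1 ∧ ∫ t in (0 : ℝ)..1, maxAlong D a t = 0

/-- `F` is a potential for the conservative field `D`; functions having such a `D` are called path
differentiable. (Integrability of the integrand along a
path is part of `IsConservativeField`: close the path to a loop by a segment.) -/
structure IsPotential (F : E → ℝ) (D : E → Set E) : Prop where
  conservative : IsConservativeField D
  eq_integral : ∀ (x : E) (a : ℝ → E), AbsolutelyContinuousOnInterval a 0 1 → a 0 = 0 → a 1 = x →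
    F x = F 0 + ∫ t in (0 : ℝ)..1, minAlong D a t

end Conservative

/-- `φ` is an almost everywhere gradient of `f`: every `f(·, s)` is locally Lipschitz and, for
`λ ⊗ μ`-almost every `(x, s)`, `f(·, s)` is differentiable at `x` with gradient `φ(x, s)`. -/
structure IsAEGradient {d : ℕ} {Ξ : Type*} [MeasurableSpace Ξ] (μ : Measure Ξ)
    (f : EuclideanSpace ℝ (Fin d) × Ξ → ℝ)
    (φ : EuclideanSpace ℝ (Fin d) × Ξ → EuclideanSpace ℝ (Fin d)) : Prop where
  locallyLipschitz : ∀ s, LocallyLipschitz fun x => f (x, s)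
  ae_hasGradientAt : ∀ᵐ p ∂((volume : Measure (EuclideanSpace ℝ (Fin d))).prod μ),
    HasGradientAt (fun x => f (x, p.2)) (φ p) p.1

/-- A directed acyclic computation graph with `d` inputs and `q > d` vertices `0, …, q - 1`.
The vertices `i < d` are the inputs (their `parents` and `func` are never used); a vertex
`i ≥ d` carries a simple function `func i` of the values at its parents. -/
structure CompGraph (d : ℕ) where
  q : ℕ
  d_lt_q : d < q
  parents : Fin q → Finset (Fin q)
  parents_lt : ∀ i, ∀ j ∈ parents i, j < i
  func : (i : Fin q) → EuclideanSpace ℝ (parents i) → ℝ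

namespace CompGraph

variable {d : ℕ} (G : CompGraph d)

/-- The value `x_i` at vertex `i` on input `x`. -/
def value (x : EuclideanSpace ℝ (Fin d)) (i : Fin G.q) : ℝ :=
  if h : i.val < d then x ⟨i.val, h⟩
  else G.func i (WithLp.toLp 2 fun j : G.parents i => value x j.1)
termination_by i
decreasing_by exact G.parents_lt i j.1 j.2

/-- The vector `(x_j)_{j ∈ parents(i)}` fed to the simple function at vertex `i`. -/
def args (x : EuclideanSpace ℝ (Fin d)) (i : Fin G.q) : EuclideanSpace ℝ (G.parents i) :=
  WithLp.toLp 2 fun j => G.value x j.1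

/-- The output vertex, i.e. the last one. -/
def out : Fin G.q := ⟨G.q - 1, Nat.sub_one_lt_of_lt G.d_lt_q⟩

/-- The function represented by the graph. -/
def eval (x : EuclideanSpace ℝ (Fin d)) : ℝ := G.value x G.out

/-- Backpropagation: `adjoint δ x i` is the formal derivative of the output with respect to
vertex `i`, accumulated by the chain rule over the vertices `k` having `i` as a parent, where
`δ k` is used as the derivative of the simple function at `k`. -/
def adjoint (δ : (k : Fin G.q) → EuclideanSpace ℝ (G.parents k) → EuclideanSpace ℝ (G.parents k))
    (x : EuclideanSpace ℝ (Fin d)) (i : Fin G.q) : ℝ :=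
  (if i = G.out then 1 else 0) +
    ∑ k : Fin G.q, if h : d ≤ k.val ∧ i ∈ G.parents k then
      adjoint δ x k * δ k (G.args x k) ⟨i, h.2⟩ else 0
termination_by G.q - i.val
decreasing_by
  exact Nat.sub_lt_sub_left i.isLt (G.parents_lt k i h.2)

/-- The output of (reverse mode) automatic differentiation at `x`. -/
def autograd
    (δ : (k : Fin G.q) → EuclideanSpace ℝ (G.parents k) → EuclideanSpace ℝ (G.parents k))
    (x : EuclideanSpace ℝ (Fin d)) : EuclideanSpace ℝ (Fin d) :=
  WithLp.toLp 2 fun i => G.adjoint δ x ⟨i.val, i.isLt.trans G.d_lt_q⟩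

/-- `δ` is an admissible derivative oracle for the graph: at every computation vertex `k`, `δ k` is
a selection of some conservative field having the simple function `func k` as a potential (in
particular `func k` is path differentiable). -/
def IsOracle
    (δ : (k : Fin G.q) → EuclideanSpace ℝ (G.parents k) → EuclideanSpace ℝ (G.parents k)) : Prop :=
  ∀ k : Fin G.q, d ≤ k.val →
    ∃ D : EuclideanSpace ℝ (G.parents k) → Set (EuclideanSpace ℝ (G.parents k)),
      IsPotential (G.func k) D ∧ ∀ z, δ k z ∈ D z

end CompGraph

end

/-! The proof rests on `HasPathGradient`: along each locally Lipschitz curve, at almost every time,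
all elements of the set-valued map give the derivative of `F` along the curve. This is weaker than
being a conservative field but survives composition, so no conservative field is built for a whole
computation graph.

A potential has this property. Traversing a path and returning gives equal integrals of the minimum
and the maximum, so the two agree almost everywhere, and differentiating the integral formula yields
the claim. Local Lipschitz continuity follows because a potential has bounded variation along
Lipschitz curves, which fails along a suitable zigzag if slopes are unbounded.

For a graph, the chain rule holds at every vertex for almost every time, and backpropagation is the
transpose of that linear recursion (`CompGraph.inner_backprop`, `CompGraph.hasPathGradient_eval`).

Finally, Fubini over parallel lines and Rademacher's theorem turn derivatives along curves into
gradients at almost every point (`HasPathGradient.ae_forall_hasGradientAt`). The passage to `λ ⊗ μ`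
is immediate for countable `Ξ`; otherwise measurability of `φ` makes `f(x, s) - f(0, s)` measurable
and Fubini applies again. -/

open Set Filter Topology Function
open scoped NNReal ENNReal Pointwise

/-! ### Potentials along Lipschitz curves. -/

section PathIntegrals

variable {E : Type*} [NormedAddCommGroup E] [InnerProductSpace ℝ E]

lemma LipschitzWith.absolutelyContinuousOnInterval {X : Type*} [PseudoMetricSpace X] {K : ℝ≥0}
    {a : ℝ → X} (ha : LipschitzWith K a) (p q : ℝ) : AbsolutelyContinuousOnInterval a p q :=
  (ha.lipschitzOnWith (s := uIcc p q)).absolutelyContinuousOnInterval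

lemma minAlong_congr {D : E → Set E} {a b : ℝ → E} {t : ℝ} (h : a =ᶠ[𝓝 t] b) :
    minAlong D a t = minAlong D b t := by
  simp only [minAlong, h.deriv_eq, h.eq_of_nhds]

lemma image_inner_smul (c : ℝ) (u : E) (s : Set E) :
    (fun v => inner ℝ (c • u) v) '' s = c • ((fun v => inner ℝ u v) '' s) := by
  rw [← image_smul, image_image]
  simp only [real_inner_smul_left, smul_eq_mul]

lemma deriv_comp_mul_add (a : ℝ → E) (c e t : ℝ) :
    deriv (fun t => a (c * t + e)) t = c • deriv a (c * t + e) := by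
  rw [deriv_comp_mul_left c (fun x => a (x + e)) t, deriv_comp_add_const]

lemma minAlong_comp_mul_add (D : E → Set E) (a : ℝ → E) {c : ℝ} (hc : 0 ≤ c) (e t : ℝ) :
    minAlong D (fun t => a (c * t + e)) t = c * minAlong D a (c * t + e) := by
  simp only [minAlong]
  rw [deriv_comp_mul_add, image_inner_smul, Real.sInf_smul_of_nonneg hc, smul_eq_mul]

lemma minAlong_comp_mul_add_of_nonpos (D : E → Set E) (a : ℝ → E) {c : ℝ} (hc : c ≤ 0) (e t : ℝ) :
    minAlong D (fun t => a (c * t + e)) t = c * maxAlong D a (c * t + e) := by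
  simp only [minAlong, maxAlong]
  rw [deriv_comp_mul_add, image_inner_smul, Real.sInf_smul_of_nonpos hc, smul_eq_mul]

lemma intervalIntegrable_comp_mul_add_iff {f : ℝ → ℝ} {c : ℝ} (hc : c ≠ 0) (e p q : ℝ) :
    IntervalIntegrable (fun t => f (c * t + e)) volume p q ↔
      IntervalIntegrable f volume (c * p + e) (c * q + e) := by
  have := IntervalIntegrable.comp_mul_left_iff (f := fun x => f (x + e)) (a := c * p) (b := c * q)
    hc
  rw [mul_div_cancel_left₀ _ hc, mul_div_cancel_left₀ _ hc] at this
  rw [this, IntervalIntegrable.comp_add_right_iff]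

variable {D : E → Set E}

lemma IsConservativeField.minAlong_le_inner (hD : IsConservativeField D) (a : ℝ → E) {t : ℝ}
    {v : E} (hv : v ∈ D (a t)) : minAlong D a t ≤ inner ℝ (deriv a t) v :=
  csInf_le ((hD.isCompact (a t)).image (by fun_prop)).bddBelow (mem_image_of_mem _ hv)

lemma IsConservativeField.inner_le_maxAlong (hD : IsConservativeField D) (a : ℝ → E) {t : ℝ}
    {v : E} (hv : v ∈ D (a t)) : inner ℝ (deriv a t) v ≤ maxAlong D a t :=
  le_csSup ((hD.isCompact (a t)).image (by fun_prop)).bddAbove (mem_image_of_mem _ hv)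

lemma IsConservativeField.minAlong_le_maxAlong (hD : IsConservativeField D) (a : ℝ → E) (t : ℝ) :
    minAlong D a t ≤ maxAlong D a t := by
  obtain ⟨v, hv⟩ := hD.nonempty (a t)
  exact (hD.minAlong_le_inner a hv).trans (hD.inner_le_maxAlong a hv)

/-- Running along a path and then back shows that the two integrands agree almost everywhere. -/
lemma IsConservativeField.intervalIntegrable_and_ae_eq (hD : IsConservativeField D) {a : ℝ → E}
    {K : ℝ≥0} (ha : LipschitzWith K a) :
    IntervalIntegrable (minAlong D a) volume 0 1 ∧
      ∀ᵐ t, t ∈ Ioc (0 : ℝ) 1 → minAlong D a t = maxAlong D a t := by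
  set b : ℝ → E := fun t => a (1 - |2 * t - 1|) with hb
  have hbl : LipschitzWith (K * 2) b := by
    refine ha.comp (LipschitzWith.of_dist_le_mul fun x y => ?_)
    rw [Real.dist_eq, Real.dist_eq, sub_sub_sub_cancel_left]
    refine (abs_abs_sub_abs_le _ _).trans (le_of_eq ?_)
    rw [show 2 * y - 1 - (2 * x - 1) = 2 * (y - x) by ring, abs_mul, abs_sub_comm]
    simp
  obtain ⟨hint, hzero⟩ := hD.loop_min b (hbl.absolutelyContinuousOnInterval 0 1)
    (by simp only [hb]; norm_num)
  have hint1 : IntervalIntegrable (minAlong D b) volume 0 (1 / 2) :=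
    hint.mono_set (by
      rw [uIcc_of_le (by norm_num), uIcc_of_le (by norm_num)]
      exact Icc_subset_Icc_right (by norm_num))
  have hint2 : IntervalIntegrable (minAlong D b) volume (1 / 2) 1 :=
    hint.mono_set (by
      rw [uIcc_of_le (by norm_num), uIcc_of_le (by norm_num)]
      exact Icc_subset_Icc_left (by norm_num))
  have h1 : EqOn (minAlong D b) (fun t => 2 * minAlong D a (2 * t + 0)) (uIoo 0 (1 / 2)) := by
    intro t ht
    rw [uIoo_of_le (by norm_num)] at ht
    beta_reduce
    rw [← minAlong_comp_mul_add D a zero_le_two]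
    apply minAlong_congr
    filter_upwards [Iio_mem_nhds ht.2] with s hs
    rw [mem_Iio] at hs
    simp only [hb]
    rw [abs_of_neg (by linarith)]
    congr 1; ring
  -- The velocity is reversed on the way back, which turns the minimum into a negative multiple of
  -- the maximum.
  have h2 : EqOn (minAlong D b) (fun t => -2 * maxAlong D a (-2 * t + 2)) (uIoo (1 / 2) 1) := by
    intro t ht
    rw [uIoo_of_le (by norm_num)] at ht
    beta_reduce
    rw [← minAlong_comp_mul_add_of_nonpos D a (by norm_num : (-2 : ℝ) ≤ 0)]
    apply minAlong_congr
    filter_upwards [Ioi_mem_nhds ht.1] with s hs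
    rw [mem_Ioi] at hs
    simp only [hb]
    rw [abs_of_pos (by linarith)]
    congr 1; ring
  have hmin : IntervalIntegrable (minAlong D a) volume 0 1 := by
    have := (hint1.congr_uIoo h1).const_mul (1 / 2)
    simp only [← mul_assoc] at this
    norm_num at this
    have := (intervalIntegrable_comp_mul_add_iff (f := minAlong D a) (two_ne_zero) 0 0 (1 / 2)).1
      (by simpa using this)
    simpa using this
  have hmax : IntervalIntegrable (maxAlong D a) volume 0 1 := by
    have := (hint2.congr_uIoo h2).const_mul (-1 / 2)
    simp only [← mul_assoc] at this
    norm_num at this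
    have := (intervalIntegrable_comp_mul_add_iff (f := maxAlong D a) (c := -2) (by norm_num)
      2 (1 / 2) 1).1 (by simpa using this)
    norm_num at this
    exact this.symm
  refine ⟨hmin, ?_⟩
  have hsub : ∫ t in (0 : ℝ)..1, (maxAlong D a t - minAlong D a t) = 0 := by
    rw [intervalIntegral.integral_sub hmax hmin]
    rw [← intervalIntegral.integral_add_adjacent_intervals hint1 hint2,
      intervalIntegral.integral_congr_uIoo h1, intervalIntegral.integral_congr_uIoo h2,
      intervalIntegral.integral_const_mul, intervalIntegral.integral_const_mul,
      intervalIntegral.integral_comp_mul_add (fun t => minAlong D a t) two_ne_zero,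
      intervalIntegral.integral_comp_mul_add (fun t => maxAlong D a t) (by norm_num)] at hzero
    norm_num at hzero
    rw [intervalIntegral.integral_symm 0 1] at hzero
    linarith
  rw [intervalIntegral.integral_eq_zero_iff_of_nonneg_ae
    (Eventually.of_forall fun t => sub_nonneg.2 (hD.minAlong_le_maxAlong a t)) (hmax.sub hmin),
    Ioc_eq_empty (by norm_num : ¬ (1 : ℝ) < 0), union_empty, EventuallyEq,
    ae_restrict_iff' measurableSet_Ioc] at hsub
  filter_upwards [hsub] with t ht htm
  have := ht htm
  simp only [Pi.zero_apply] at this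
  linarith

variable {F : E → ℝ}

/-- The definition only covers paths starting at `0`, so `a` is preceded by the segment from `0` to
`a 0`, whose contribution is subtracted. -/
lemma IsPotential.sub_eq_integral_zero_one (hF : IsPotential F D) {a : ℝ → E} {K : ℝ≥0}
    (ha : LipschitzWith K a) : F (a 1) - F (a 0) = ∫ t in (0 : ℝ)..1, minAlong D a t := by
  set r : ℝ → E := fun t => t • a 0 with hr
  have hrl : LipschitzWith ‖a 0‖₊ r := by
    refine LipschitzWith.of_dist_le_mul fun x y => ?_
    simp only [hr]
    rw [dist_eq_norm, ← sub_smul, norm_smul, mul_comm, ← dist_eq_norm, coe_nnnorm]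
  have hmax : LipschitzWith 2 fun t : ℝ => max (2 * t - 1) 0 := by
    refine LipschitzWith.max_const (LipschitzWith.of_dist_le_mul fun x y => ?_) 0
    rw [Real.dist_eq, Real.dist_eq, show 2 * x - 1 - (2 * y - 1) = 2 * (x - y) by ring, abs_mul]
    simp
  have hmin : LipschitzWith 2 fun t : ℝ => min (2 * t - 1) 0 := by
    refine LipschitzWith.min_const (LipschitzWith.of_dist_le_mul fun x y => ?_) 0
    rw [Real.dist_eq, Real.dist_eq, show 2 * x - 1 - (2 * y - 1) = 2 * (x - y) by ring, abs_mul]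
    simp
  -- The concatenated path: `r (2t)` up to time `1/2`, then `a (2t - 1)`. Writing it as a sum makes
  -- the Lipschitz bound immediate.
  set c : ℝ → E := fun t => a (max (2 * t - 1) 0) + r (min (2 * t - 1) 0) with hc
  have hcl : LipschitzWith (K * 2 + ‖a 0‖₊ * 2) c := (ha.comp hmax).add (hrl.comp hmin)
  have hcint := (hF.conservative.intervalIntegrable_and_ae_eq hcl).1
  have hc1 : EqOn (minAlong D c) (fun t => 2 * minAlong D r (2 * t + 0)) (uIoo 0 (1 / 2)) := by
    intro t ht
    rw [uIoo_of_le (by norm_num)] at ht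
    beta_reduce
    rw [← minAlong_comp_mul_add D r zero_le_two]
    apply minAlong_congr
    filter_upwards [Iio_mem_nhds ht.2] with s hs
    rw [mem_Iio] at hs
    simp only [hc, hr]
    rw [max_eq_right (by linarith), min_eq_left (by linarith), sub_smul, add_zero]
    simp
  have hc2 : EqOn (minAlong D c) (fun t => 2 * minAlong D a (2 * t + -1)) (uIoo (1 / 2) 1) := by
    intro t ht
    rw [uIoo_of_le (by norm_num)] at ht
    beta_reduce
    rw [← minAlong_comp_mul_add D a zero_le_two]
    apply minAlong_congr
    filter_upwards [Ioi_mem_nhds ht.1] with s hs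
    rw [mem_Ioi] at hs
    simp only [hc, hr]
    rw [max_eq_left (by linarith), min_eq_right (by linarith), zero_smul, add_zero, sub_eq_add_neg]
  have e1 := hF.eq_integral (a 0) r (hrl.absolutelyContinuousOnInterval 0 1) (by simp [hr])
    (by simp [hr])
  have e2 := hF.eq_integral (a 1) c (hcl.absolutelyContinuousOnInterval 0 1)
    (by simp [hc, hr]) (by simp only [hc, hr]; norm_num)
  have hint1 : IntervalIntegrable (minAlong D c) volume 0 (1 / 2) :=
    hcint.mono_set (by
      rw [uIcc_of_le (by norm_num), uIcc_of_le (by norm_num)]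
      exact Icc_subset_Icc_right (by norm_num))
  have hint2 : IntervalIntegrable (minAlong D c) volume (1 / 2) 1 :=
    hcint.mono_set (by
      rw [uIcc_of_le (by norm_num), uIcc_of_le (by norm_num)]
      exact Icc_subset_Icc_left (by norm_num))
  rw [← intervalIntegral.integral_add_adjacent_intervals hint1 hint2,
    intervalIntegral.integral_congr_uIoo hc1, intervalIntegral.integral_congr_uIoo hc2,
    intervalIntegral.integral_const_mul, intervalIntegral.integral_const_mul,
    intervalIntegral.integral_comp_mul_add (fun t => minAlong D r t) two_ne_zero,
    intervalIntegral.integral_comp_mul_add (fun t => minAlong D a t) two_ne_zero] at e2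
  norm_num at e2
  linarith

lemma IsPotential.sub_eq_integral (hF : IsPotential F D) {a : ℝ → E} {K : ℝ≥0}
    (ha : LipschitzWith K a) {u : ℝ} (hu : 0 ≤ u) :
    F (a u) - F (a 0) = ∫ t in (0 : ℝ)..u, minAlong D a t := by
  rcases hu.eq_or_lt with rfl | hu'
  · simp
  have hl : LipschitzWith (K * ‖u‖₊) fun t => a (u * t + 0) := by
    refine ha.comp (LipschitzWith.of_dist_le_mul fun x y => ?_)
    rw [Real.dist_eq, Real.dist_eq, add_sub_add_right_eq_sub, ← mul_sub, abs_mul]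
    simp
  have := hF.sub_eq_integral_zero_one hl
  simp_rw [minAlong_comp_mul_add D a hu] at this
  rw [intervalIntegral.integral_const_mul,
    intervalIntegral.integral_comp_mul_add (fun t => minAlong D a t) hu'.ne'] at this
  simpa [hu'.ne'] using this

/-- Every `⟪ȧ, v⟫` is squeezed between minimum and maximum, which agree almost everywhere; Lebesgue
differentiation does the rest. -/
lemma IsPotential.ae_hasDerivAt_of_lipschitzWith (hF : IsPotential F D) {a : ℝ → E} {K : ℝ≥0}
    (ha : LipschitzWith K a) :
    ∀ᵐ t, t ∈ Ioo (0 : ℝ) 1 →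
      ∀ v ∈ D (a t), HasDerivAt (fun t => F (a t)) (inner ℝ (deriv a t) v) t := by
  obtain ⟨hint, hae⟩ := hF.conservative.intervalIntegrable_and_ae_eq ha
  filter_upwards [hae, hint.ae_hasDerivAt_integral] with t h1 h2 ht v hv
  have hv' : inner ℝ (deriv a t) v = minAlong D a t :=
    le_antisymm ((hF.conservative.inner_le_maxAlong a hv).trans_eq (h1 (Ioo_subset_Ioc_self ht)).symm)
      (hF.conservative.minAlong_le_inner a hv)
  rw [uIcc_of_le zero_le_one] at h2
  have h3 := (h2 (Ioo_subset_Icc_self ht) 0 (left_mem_Icc.2 zero_le_one)).add_const (F (a 0))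
  rw [hv']
  refine h3.congr_of_eventuallyEq ?_
  filter_upwards [Ioi_mem_nhds ht.1] with s hs
  rw [← hF.sub_eq_integral ha (le_of_lt hs)]
  ring

lemma IsPotential.boundedVariationOn_comp (hF : IsPotential F D) {a : ℝ → E} {K : ℝ≥0}
    (ha : LipschitzWith K a) : BoundedVariationOn (fun t => F (a t)) (Icc 0 1) := by
  have hint := (hF.conservative.intervalIntegrable_and_ae_eq ha).1
  have := ((LipschitzWith.const (F (a 0))).absolutelyContinuousOnInterval 0 1).add
    (hint.absolutelyContinuousOnInterval_intervalIntegral left_mem_uIcc) |>.boundedVariationOn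
  rw [uIcc_of_le zero_le_one] at this
  unfold BoundedVariationOn at this ⊢
  rwa [eVariationOn.congr fun t ht => ?_]
  simp only [Pi.add_apply]
  rw [← hF.sub_eq_integral ha ht.1]
  ring

end PathIntegrals

/-! ### Local Lipschitz continuity from bounded variation along curves. -/

section LocallyLipschitz

lemma exists_lipschitzWith_interpolation {E ι : Type*} [NormedAddCommGroup E] [NormedSpace ℝ E]
    [FiniteDimensional ℝ E] {τ : ι → ℝ} {p : ι → E} {C : ℝ≥0}
    (h : ∀ i j, dist (p i) (p j) ≤ C * dist (τ i) (τ j)) :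
    ∃ (K : ℝ≥0) (a : ℝ → E), LipschitzWith K a ∧ ∀ i, a (τ i) = p i := by
  have hfac : p.FactorsThrough τ := fun i j hij => by
    have := h i j
    rw [hij, dist_self, mul_zero] at this
    exact dist_le_zero.1 this
  have hL : LipschitzOnWith C (extend τ p 0) (range τ) := by
    refine LipschitzOnWith.of_dist_le_mul ?_
    rintro _ ⟨i, rfl⟩ _ ⟨j, rfl⟩
    rw [hfac.extend_apply, hfac.extend_apply]
    exact h i j
  obtain ⟨a, ha, hEq⟩ := hL.extend_finite_dimension
  exact ⟨_, a, ha, fun i => by rw [← hEq (mem_range_self i), hfac.extend_apply]⟩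

/-- A function with bounded variation along all Lipschitz curves is locally Lipschitz: otherwise
there is a convergent sequence of segments with unbounded slopes, and a Lipschitz curve which
oscillates sufficiently often along each of them. -/
lemma locallyLipschitz_of_boundedVariationOn_comp {E : Type*} [NormedAddCommGroup E]
    [NormedSpace ℝ E] [FiniteDimensional ℝ E] {F : E → ℝ}
    (hF : ∀ (a : ℝ → E) (K : ℝ≥0), LipschitzWith K a →
      BoundedVariationOn (fun t => F (a t)) (Icc 0 1)) : LocallyLipschitz F := by
  intro x
  by_contra! hx
  set h : ℕ → ℝ := fun n => (1 / 2) ^ n with hh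
  have hpos : ∀ n, 0 < h n := fun n => by positivity
  have hle : ∀ n, h n ≤ 1 := fun n => pow_le_one₀ (by norm_num) (by norm_num)
  have hex : ∀ n : ℕ, ∃ y z : E, dist y x < h n ∧ dist z x < h n ∧
      4 ^ n * dist y z < dist (F y) (F z) := by
    intro n
    have := hx (4 ^ n) (Metric.ball x (h n)) (Metric.ball_mem_nhds x (hpos n))
    rw [lipschitzOnWith_iff_dist_le_mul] at this
    push Not at this
    obtain ⟨y, hy, z, hz, hyz⟩ := this
    exact ⟨y, z, hy, hz, by simpa using hyz⟩
  choose y z hy hz hyz using hex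
  set r : ℕ → ℝ := fun n => dist (y n) (z n) with hr
  have hrpos : ∀ n, 0 < r n := fun n => by
    refine dist_pos.2 fun he => ?_
    have := hyz n
    simp [he] at this
  have hrlt : ∀ n, r n < 2 * h n := fun n => by
    have := dist_triangle_right (y n) (z n) x
    have := hy n
    have := hz n
    simp only [hr]
    linarith
  -- The number of crossings between `y n` and `z n` makes the length of the `n`-th zigzag
  -- comparable to `h n`.
  set k : ℕ → ℕ := fun n => ⌈h n / r n⌉₊ with hk
  have hkpos : ∀ n, 0 < (k n : ℝ) := fun n =>
    Nat.cast_pos.2 (Nat.ceil_pos.2 (div_pos (hpos n) (hrpos n)))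
  have hk1 : ∀ n, h n ≤ k n * r n := fun n => (div_le_iff₀ (hrpos n)).1 (Nat.le_ceil _)
  have hk2 : ∀ n, k n * r n ≤ 3 * h n := fun n => by
    have h1 : (k n : ℝ) ≤ h n / r n + 1 := (Nat.ceil_lt_add_one (div_pos (hpos n) (hrpos n)).le).le
    have h2 := mul_le_mul_of_nonneg_right h1 (hrpos n).le
    rw [add_mul, div_mul_cancel₀ _ (hrpos n).ne', one_mul] at h2
    have := hrlt n
    linarith
  -- The `n`-th zigzag occupies `[1 - h n, 1 - 3/4 * h n]`. Length at most `3 * h n` in time `h n /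
  -- 4` gives the speed bound `12`; the gap before the next zigzag is at least `h n / 4`.
  set τ : ℕ → ℕ → ℝ := fun n j => 1 - h n + h n / 4 * (j / k n) with hτ
  set p : ℕ → ℕ → E := fun n j => if Even j then y n else z n with hp
  have hpx : ∀ n j, dist (p n j) x ≤ h n := fun n j => by
    simp only [hp]
    split_ifs
    exacts [(hy n).le, (hz n).le]
  have hτ1 : ∀ n j, 1 - h n ≤ τ n j := fun n j => by
    have := hpos n
    have := hkpos n
    simp only [hτ]
    have : 0 ≤ h n / 4 * (j / k n) := by positivity
    linarith
  have hτ2 : ∀ n j, j ≤ k n → τ n j ≤ 1 - 3 / 4 * h n := fun n j hj => by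
    have h1 : (j : ℝ) / k n ≤ 1 := (div_le_one (hkpos n)).2 (Nat.cast_le.2 hj)
    have h2 := mul_le_mul_of_nonneg_left h1 (by linarith [hpos n] : 0 ≤ h n / 4)
    simp only [hτ]
    linarith
  have hdiff : ∀ n m j l, n < m → j ≤ k n → dist (p n j) (p m l) ≤ 12 * dist (τ n j) (τ m l) := by
    intro n m j l hnm hj
    have h1 := dist_triangle_right (p n j) (p m l) x
    have h2 : h m ≤ h n / 2 := by
      calc h m ≤ h (n + 1) := pow_le_pow_of_le_one (by norm_num) (by norm_num) hnm
        _ = h n / 2 := by simp only [hh, pow_succ]; ring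
    have h3 := hpx n j
    have h4 := hpx m l
    have h5 := hτ2 n j hj
    have h6 := hτ1 m l
    rw [dist_comm (τ n j), Real.dist_eq]
    have h7 := le_abs_self (τ m l - τ n j)
    linarith [hpos n]
  have hsame : ∀ n j l, dist (p n j) (p n l) ≤ 12 * dist (τ n j) (τ n l) := by
    intro n j l
    rcases eq_or_ne j l with rfl | hjl
    · simp
    have h1 : dist (p n j) (p n l) ≤ r n := by
      simp only [hp, hr]
      split_ifs
      · simp
      · exact le_rfl
      · rw [dist_comm]
      · simp
    have h2 : dist (τ n j) (τ n l) = h n / 4 / k n * |(j : ℝ) - l| := by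
      rw [Real.dist_eq, ← abs_of_pos (div_pos (div_pos (hpos n) zero_lt_four) (hkpos n)), ← abs_mul]
      congr 1
      simp only [hτ]
      ring
    have h3 : (1 : ℝ) ≤ |(j : ℝ) - l| := by
      have : (1 : ℤ) ≤ |(j : ℤ) - l| := Int.one_le_abs (sub_ne_zero.2 (by exact_mod_cast hjl))
      exact_mod_cast this
    have h4 : r n ≤ 3 * h n / k n := (le_div_iff₀ (hkpos n)).2 (by linarith [hk2 n])
    have h5 : h n / 4 / k n * 1 ≤ h n / 4 / k n * |(j : ℝ) - l| :=
      mul_le_mul_of_nonneg_left h3 (div_pos (div_pos (hpos n) zero_lt_four) (hkpos n)).le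
    rw [h2]
    have h6 : 3 * h n / k n = 12 * (h n / 4 / k n * 1) := by ring
    linarith
  obtain ⟨K, a, ha, hap⟩ := exists_lipschitzWith_interpolation
    (ι := {i : ℕ × ℕ // i.2 ≤ k i.1}) (τ := fun i => τ i.1.1 i.1.2) (p := fun i => p i.1.1 i.1.2)
    (C := 12) (by
      rintro ⟨⟨n, j⟩, hj⟩ ⟨⟨m, l⟩, hl⟩
      simp only [NNReal.coe_ofNat] at hj hl ⊢
      rcases lt_trichotomy n m with hnm | rfl | hnm
      · exact hdiff n m j l hnm hj
      · exact hsame n j l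
      · rw [dist_comm, dist_comm (τ n j)]
        exact hdiff m n l j hnm hl)
  have hbv := hF a K ha
  -- Each crossing changes `F` by more than `4 ^ n * r n`, so the `n`-th zigzag contributes at least
  -- `4 ^ n * h n = 2 ^ n`.
  have hlow : ∀ n : ℕ, ENNReal.ofReal (2 ^ n) ≤ eVariationOn (fun t => F (a t)) (Icc 0 1) := by
    intro n
    have hmono : MonotoneOn (τ n) (Iic (k n)) := by
      refine Monotone.monotoneOn (fun i j hij => ?_) _
      simp only [hτ]
      have := hpos n
      have := hkpos n
      gcongr
    refine le_trans ?_ (eVariationOn.sum_le_of_monotoneOn_Iic (u := τ n) hmono fun j hj => ?_)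
    · have hterm : ∀ j ∈ Finset.range (k n), ENNReal.ofReal (4 ^ n * r n) ≤
          edist (F (a (τ n (j + 1)))) (F (a (τ n j))) := by
        intro j hj
        rw [Finset.mem_range] at hj
        have e1 : a (τ n (j + 1)) = p n (j + 1) := hap ⟨(n, j + 1), hj⟩
        have e2 : a (τ n j) = p n j := hap ⟨(n, j), hj.le⟩
        rw [e1, e2, edist_dist]
        refine ENNReal.ofReal_le_ofReal ((hyz n).le.trans ?_)
        simp only [hp, Nat.even_add_one]
        by_cases hev : Even j
        · simp [hev, dist_comm]
        · simp [hev]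
      refine le_trans ?_ (Finset.sum_le_sum hterm)
      rw [Finset.sum_const, Finset.card_range, nsmul_eq_mul, ← ENNReal.ofReal_natCast,
        ← ENNReal.ofReal_mul (hkpos n).le]
      refine ENNReal.ofReal_le_ofReal ?_
      calc (2 : ℝ) ^ n = 4 ^ n * h n := by
            simp only [hh]
            rw [← mul_pow]
            norm_num
        _ ≤ 4 ^ n * (k n * r n) := by gcongr; exact hk1 n
        _ = k n * (4 ^ n * r n) := by ring
    · exact ⟨by linarith [hτ1 n j, hle n], by linarith [hτ2 n j hj, hpos n]⟩
  obtain ⟨n, hn⟩ := pow_unbounded_of_one_lt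
    (eVariationOn (fun t => F (a t)) (Icc 0 1)).toReal (one_lt_two)
  have := (ENNReal.ofReal_le_iff_le_toReal hbv).1 (hlow n)
  linarith

end LocallyLipschitz

/-! ### Set-valued gradients along curves. -/

section PathGradient

variable {E : Type*} [NormedAddCommGroup E] [InnerProductSpace ℝ E]

/-- `J` is a set-valued gradient of `F` along curves: for every locally Lipschitz curve, all
elements of `J` give the derivative of `F` along the curve at almost every time. -/
structure HasPathGradient (F : E → ℝ) (J : E → Set E) : Prop where
  locallyLipschitz : LocallyLipschitz F
  isSigmaCompact_graph : IsSigmaCompact {p : E × E | p.2 ∈ J p.1}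
  ae_hasDerivAt : ∀ a : ℝ → E, LocallyLipschitz a → ∀ᵐ t, ∀ v ∈ J (a t),
    HasDerivAt (fun t => F (a t)) (inner ℝ (deriv a t) v) t

lemma lipschitzWith_min_max {p q : ℝ} :
    LipschitzWith 1 fun t : ℝ => min (max t p) q :=
  (LipschitzWith.id.max_const p).min_const q

lemma LocallyLipschitz.exists_lipschitzWith_comp_min_max {X : Type*} [PseudoMetricSpace X]
    {a : ℝ → X} (ha : LocallyLipschitz a) {p q : ℝ} (hpq : p ≤ q) :
    ∃ K, LipschitzWith K fun t => a (min (max t p) q) := by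
  obtain ⟨K, hK⟩ := ha.locallyLipschitzOn.exists_lipschitzOnWith_of_compact
    (isCompact_Icc (a := p) (b := q))
  refine ⟨K * 1, ?_⟩
  rw [← lipschitzOnWith_univ] at *
  exact hK.comp lipschitzWith_min_max.lipschitzOnWith
    fun t _ => ⟨le_min (le_max_right _ _) hpq, min_le_right _ _⟩

/-- Countably many unit intervals with rational left endpoints cover the line; on each, the curve
agrees with a clamped, globally Lipschitz one. -/
lemma IsPotential.ae_hasDerivAt {F : E → ℝ} {D : E → Set E} (hF : IsPotential F D) {a : ℝ → E}
    (ha : LocallyLipschitz a) :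
    ∀ᵐ t, ∀ v ∈ D (a t), HasDerivAt (fun t => F (a t)) (inner ℝ (deriv a t) v) t := by
  have key : ∀ q : ℚ, ∀ᵐ s : ℝ, s - q ∈ Ioo (0 : ℝ) 1 → ∀ v ∈ D (a s),
      HasDerivAt (fun t => F (a t)) (inner ℝ (deriv a s) v) s := by
    intro q
    obtain ⟨K, hK⟩ := ha.exists_lipschitzWith_comp_min_max (p := q) (q := q + 1) (by linarith)
    set b : ℝ → E := fun t => a (min (max (t + q) q) (q + 1)) with hb
    have hbl : LipschitzWith (K * 1) b :=
      hK.comp (LipschitzWith.of_dist_le_mul (f := fun t : ℝ => t + q) fun x y => by simp)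
    filter_upwards [(measurePreserving_sub_right volume (q : ℝ)).quasiMeasurePreserving.ae
      (hF.ae_hasDerivAt_of_lipschitzWith hbl)] with s hs hsq v hv
    have hba : (fun t => b (t - q)) =ᶠ[𝓝 s] a := by
      filter_upwards [Ioo_mem_nhds (a := (q : ℝ)) (b := q + 1) (x := s) (by linarith [hsq.1])
        (by linarith [hsq.2])] with t ht
      simp only [hb, sub_add_cancel]
      rw [max_eq_left ht.1.le, min_eq_left ht.2.le]
    have hd : deriv b (s - q) = deriv a s := by
      rw [← hba.deriv_eq, deriv_comp_sub_const]
    have h1 := hs hsq v (by rwa [show b (s - q) = a s from hba.eq_of_nhds])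
    rw [hd] at h1
    refine (h1.comp_sub_const s (q : ℝ)).congr_of_eventuallyEq ?_
    filter_upwards [hba] with t ht
    rw [← ht]
  filter_upwards [ae_all_iff.2 key] with t ht
  obtain ⟨q, hq1, hq2⟩ := exists_rat_btwn (show t - 1 < t by linarith)
  exact ht q ⟨by linarith, by linarith⟩

lemma IsPotential.hasPathGradient [FiniteDimensional ℝ E] {F : E → ℝ} {D : E → Set E}
    (hF : IsPotential F D) : HasPathGradient F D where
  locallyLipschitz :=
    locallyLipschitz_of_boundedVariationOn_comp fun _ _ ha => hF.boundedVariationOn_comp ha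
  isSigmaCompact_graph := by
    have : ProperSpace E := FiniteDimensional.proper ℝ E
    exact isSigmaCompact_univ.of_isClosed_subset hF.conservative.isClosed_graph (subset_univ _)
  ae_hasDerivAt _ ha := hF.ae_hasDerivAt ha

end PathGradient

/-! ### From curves to almost every point. -/

section AlmostEverywhere

variable {E : Type*} [NormedAddCommGroup E] [InnerProductSpace ℝ E]

lemma IsSigmaCompact.measurableSet {X : Type*} [TopologicalSpace X] [T2Space X]
    [MeasurableSpace X] [OpensMeasurableSpace X] {s : Set X} (hs : IsSigmaCompact s) :
    MeasurableSet s := by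
  obtain ⟨K, hK, rfl⟩ := hs
  exact MeasurableSet.iUnion fun n => (hK n).measurableSet

lemma LocallyLipschitz.ae_differentiableAt [FiniteDimensional ℝ E] [MeasurableSpace E]
    [BorelSpace E] {μ : Measure E} [μ.IsAddHaarMeasure] {V : Type*} [NormedAddCommGroup V]
    [NormedSpace ℝ V] [FiniteDimensional ℝ V] {F : E → V} (hF : LocallyLipschitz F) :
    ∀ᵐ x ∂μ, DifferentiableAt ℝ F x := by
  have : ProperSpace E := FiniteDimensional.proper ℝ E
  have key : ∀ n : ℕ, ∀ᵐ x ∂μ, x ∈ Metric.closedBall (0 : E) n →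
      DifferentiableWithinAt ℝ F (Metric.closedBall (0 : E) n) x := fun n =>
    (hF.locallyLipschitzOn.exists_lipschitzOnWith_of_compact
      (isCompact_closedBall (0 : E) n)).elim fun _ h => h.ae_differentiableWithinAt_of_mem
  filter_upwards [ae_all_iff.2 key] with x hx
  obtain ⟨n, hn⟩ := exists_nat_gt ‖x‖
  have hxn : x ∈ Metric.ball (0 : E) n := by simpa using hn
  exact (hx n (Metric.ball_subset_closedBall hxn)).differentiableAt
    (mem_of_superset (Metric.isOpen_ball.mem_nhds hxn) Metric.ball_subset_closedBall)

namespace HasPathGradient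

variable {F : E → ℝ} {J : E → Set E}

/-- Projections of Borel sets need not be Borel, but those of σ-compact sets are again σ-compact.
This is the purpose of the graph condition in `HasPathGradient`. -/
lemma measurableSet_forall_inner_eq [FiniteDimensional ℝ E] [MeasurableSpace E] [BorelSpace E]
    (h : HasPathGradient F J) (v : E) :
    MeasurableSet {x | ∀ w ∈ J x, inner ℝ v w = lineDeriv ℝ F x v} := by
  have : ProperSpace E := FiniteDimensional.proper ℝ E
  have hproj : ∀ C : Set ℝ, IsClosed C → MeasurableSet {x | ∃ w ∈ J x, inner ℝ v w ∈ C} := by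
    intro C hC
    have hs : IsSigmaCompact ({p : E × E | p.2 ∈ J p.1} ∩ {p | inner ℝ v p.2 ∈ C}) := by
      obtain ⟨K, hK, hKe⟩ := h.isSigmaCompact_graph
      rw [← hKe, iUnion_inter]
      exact isSigmaCompact_iUnion_of_isCompact _ fun n =>
        (hK n).inter_right (hC.preimage (by fun_prop : Continuous fun p : E × E => inner ℝ v p.2))
    convert (hs.image continuous_fst).measurableSet using 1
    ext x
    simp
  have hm : Measurable fun x => lineDeriv ℝ F x v :=
    measurable_lineDeriv h.locallyLipschitz.continuous
  -- Unequal numbers are separated by a rational. The inequality on the side of `w` is kept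
  -- non-strict so that only closed conditions are projected.
  have hset : {x | ∀ w ∈ J x, inner ℝ v w = lineDeriv ℝ F x v} =
      ⋂ q : ℚ, ({x | lineDeriv ℝ F x v < q} ∩ {x | ∃ w ∈ J x, inner ℝ v w ∈ Ici (q : ℝ)})ᶜ ∩
        ({x | q < lineDeriv ℝ F x v} ∩ {x | ∃ w ∈ J x, inner ℝ v w ∈ Iic (q : ℝ)})ᶜ := by
    ext x
    simp only [mem_ofPred_eq, mem_iInter, mem_inter_iff, mem_compl_iff, mem_Ici, mem_Iic]
    constructor
    · intro hx q
      refine ⟨?_, ?_⟩ <;>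
      · rintro ⟨h1, w, hw, h2⟩
        rw [hx w hw] at h2
        linarith
    · intro hx w hw
      by_contra hne
      rcases lt_or_gt_of_ne hne with hlt | hlt <;> obtain ⟨q, h1, h2⟩ := exists_rat_btwn hlt
      · exact (hx q).2 ⟨h2, w, hw, h1.le⟩
      · exact (hx q).1 ⟨h1, w, hw, h2.le⟩
  rw [hset]
  exact MeasurableSet.iInter fun q =>
    ((measurableSet_lt hm measurable_const).inter (hproj _ isClosed_Ici)).compl.inter
      ((measurableSet_lt measurable_const hm).inter (hproj _ isClosed_Iic)).compl

/-- Along each line `t ↦ p + t • v` the identity holds for almost every `t`; Fubini in direction `v`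
concludes. -/
lemma ae_forall_inner_eq [FiniteDimensional ℝ E] [MeasurableSpace E] [BorelSpace E]
    {μ : Measure E} [μ.IsAddHaarMeasure] (h : HasPathGradient F J) (v : E) :
    ∀ᵐ x ∂μ, ∀ w ∈ J x, inner ℝ v w = lineDeriv ℝ F x v := by
  have : ProperSpace E := FiniteDimensional.proper ℝ E
  let L : ℝ →L[ℝ] E := ContinuousLinearMap.smulRight (1 : ℝ →L[ℝ] ℝ) v
  suffices A : ∀ p, ∀ᵐ (t : ℝ) ∂volume,
      p + t • v ∈ {x | ∀ w ∈ J x, inner ℝ v w = lineDeriv ℝ F x v} from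
    ae_mem_of_ae_add_linearMap_mem L.toLinearMap volume μ (h.measurableSet_forall_inner_eq v) A
  intro p
  have hd : ∀ t : ℝ, HasDerivAt (fun t : ℝ => p + t • v) v t := fun t => by
    simpa using ((hasDerivAt_id t).smul_const v).const_add p
  have hl : LocallyLipschitz fun t : ℝ => p + t • v :=
    ((LipschitzWith.const p).add L.lipschitz).locallyLipschitz
  filter_upwards [h.ae_hasDerivAt _ hl] with t ht w hw
  have h1 := ht w hw
  rw [(hd t).deriv] at h1
  refine Eq.symm (HasLineDerivAt.lineDeriv (HasDerivAt.congr_deriv (f' := inner ℝ v w) ?_ rfl))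
  rw [← add_zero t] at h1
  refine (h1.comp_const_add t 0).congr_of_eventuallyEq (Eventually.of_forall fun s => ?_)
  simp only [add_smul, add_assoc]

/-- Almost everywhere, the set-valued gradient is contained in `{∇ F x}`. -/
theorem ae_forall_hasGradientAt [FiniteDimensional ℝ E] [MeasurableSpace E] [BorelSpace E]
    {μ : Measure E} [μ.IsAddHaarMeasure] (h : HasPathGradient F J) :
    letI : CompleteSpace E := FiniteDimensional.complete ℝ E
    ∀ᵐ x ∂μ, ∀ w ∈ J x, HasGradientAt F w x := by
  have : CompleteSpace E := FiniteDimensional.complete ℝ E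
  filter_upwards [h.locallyLipschitz.ae_differentiableAt,
    ae_all_iff.2 fun i => h.ae_forall_inner_eq (μ := μ) (stdOrthonormalBasis ℝ E i)] with x hx hJ w hw
  rw [hasGradientAt_iff_hasFDerivAt]
  refine hx.hasFDerivAt.congr_fderiv (ContinuousLinearMap.coe_injective ?_)
  refine (stdOrthonormalBasis ℝ E).toBasis.ext fun i => ?_
  have := hJ i w hw
  rw [hx.lineDeriv_eq_fderiv] at this
  simpa [real_inner_comm] using this.symm

/-- Recovers `F` up to a constant from a selection, so that measurability passes from the selection
to `F`. -/
lemma sub_eq_integral {φ : E → E} (h : HasPathGradient F J) (hφ : ∀ x, φ x ∈ J x) (x : E) :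
    F x - F 0 = ∫ t in (0 : ℝ)..1, inner ℝ x (φ (t • x)) := by
  have hd : ∀ t : ℝ, HasDerivAt (fun t : ℝ => t • x) x t := fun t => by
    simpa using (hasDerivAt_id t).smul_const x
  have hl : LocallyLipschitz fun t : ℝ => t • x :=
    (ContinuousLinearMap.smulRight (1 : ℝ →L[ℝ] ℝ) x).lipschitz.locallyLipschitz
  obtain ⟨K, hK⟩ := (h.locallyLipschitz.comp hl).locallyLipschitzOn.exists_lipschitzOnWith_of_compact
    (isCompact_uIcc (a := (0 : ℝ)) (b := 1))
  have h1 := hK.absolutelyContinuousOnInterval.integral_deriv_eq_sub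
  simp only [comp_apply, one_smul, zero_smul] at h1
  rw [← h1]
  refine intervalIntegral.integral_congr_ae ?_
  filter_upwards [h.ae_hasDerivAt _ hl] with t ht _
  have := (ht _ (hφ _)).deriv
  rw [(hd t).deriv] at this
  exact this

end HasPathGradient

/-- For continuous `F` the error bound is a closed condition on the increment, so a countable dense
set suffices. -/
lemma hasGradientAt_iff_forall_exists_nat [CompleteSpace E] {F : E → ℝ} (hF : Continuous F)
    {u : ℕ → E} (hu : DenseRange u) {w x : E} :
    HasGradientAt F w x ↔ ∀ n : ℕ, ∃ m : ℕ, ∀ k : ℕ, ‖u k‖ < 1 / (m + 1 : ℝ) →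
      |F (x + u k) - F x - inner ℝ w (u k)| ≤ 1 / (n + 1 : ℝ) * ‖u k‖ := by
  rw [hasGradientAt_iff_hasFDerivAt, hasFDerivAt_iff_isLittleO_nhds_zero, Asymptotics.isLittleO_iff]
  simp only [InnerProductSpace.toDual_apply_apply, Real.norm_eq_abs]
  constructor
  · intro h n
    obtain ⟨δ, hδ, hball⟩ := Metric.eventually_nhds_iff.1 (h (Nat.one_div_pos_of_nat (n := n)))
    obtain ⟨m, hm⟩ := exists_nat_one_div_lt hδ
    exact ⟨m, fun k hk => hball (by simpa using hk.trans hm)⟩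
  · intro h c hc
    obtain ⟨n, hn⟩ := exists_nat_one_div_lt hc
    obtain ⟨m, hm⟩ := h n
    have hball : Metric.ball (0 : E) (1 / (m + 1 : ℝ)) ∈ 𝓝 (0 : E) :=
      Metric.ball_mem_nhds _ Nat.one_div_pos_of_nat
    filter_upwards [hball] with y hy
    have hcl : IsClosed {y : E | |F (x + y) - F x - inner ℝ w y| ≤ 1 / (n + 1 : ℝ) * ‖y‖} :=
      isClosed_le (by fun_prop) (by fun_prop)
    have hy' : y ∈ closure (Metric.ball (0 : E) (1 / (m + 1 : ℝ)) ∩ range u) :=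
      hu.open_subset_closure_inter Metric.isOpen_ball hy
    have hsub : Metric.ball (0 : E) (1 / (m + 1 : ℝ)) ∩ range u ⊆
        {y : E | |F (x + y) - F x - inner ℝ w y| ≤ 1 / (n + 1 : ℝ) * ‖y‖} := by
      rintro _ ⟨hk, k, rfl⟩
      exact hm k (by simpa using hk)
    exact (closure_minimal hsub hcl hy').trans (by gcongr)

/-- Selections of set-valued gradients along curves are almost everywhere gradients. -/
theorem isAEGradient_of_hasPathGradient {d : ℕ} {Ξ : Type*} [MeasurableSpace Ξ] {μ : Measure Ξ}
    [SFinite μ] {f : EuclideanSpace ℝ (Fin d) × Ξ → ℝ}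
    {J : Ξ → EuclideanSpace ℝ (Fin d) → Set (EuclideanSpace ℝ (Fin d))}
    {φ : EuclideanSpace ℝ (Fin d) × Ξ → EuclideanSpace ℝ (Fin d)}
    (hJ : ∀ s, HasPathGradient (fun x => f (x, s)) (J s)) (hφ : ∀ x s, φ (x, s) ∈ J s x)
    (hm : Countable Ξ ∨ Measurable φ) : IsAEGradient μ f φ := by
  refine ⟨fun s => (hJ s).locallyLipschitz, ?_⟩
  have hae : ∀ s, ∀ᵐ x, HasGradientAt (fun x => f (x, s)) (φ (x, s)) x := fun s => by
    filter_upwards [(hJ s).ae_forall_hasGradientAt (μ := volume)] with x hx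
    exact hx _ (hφ x s)
  rcases hm with hc | hm
  · filter_upwards [Measure.quasiMeasurePreserving_fst.ae (ae_all_iff.2 hae)] with p hp
    exact hp p.2
  -- No measurability of `f` is assumed, and `s ↦ f (0, s)` may fail to be measurable; only
  -- increments of `f` matter, so it is subtracted throughout.
  · have hsub : Measurable fun p : EuclideanSpace ℝ (Fin d) × Ξ => f p - f (0, p.2) := by
      have hint : ∀ p : EuclideanSpace ℝ (Fin d) × Ξ, f p - f (0, p.2) =
          ∫ t in Ioc (0 : ℝ) 1, inner ℝ p.1 (φ (t • p.1, p.2)) := fun p => by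
        rw [← intervalIntegral.integral_of_le zero_le_one]
        exact (hJ p.2).sub_eq_integral (fun x => hφ x p.2) p.1
      simp_rw [hint]
      have hmeas : Measurable fun z : (EuclideanSpace ℝ (Fin d) × Ξ) × ℝ =>
          inner ℝ z.1.1 (φ (z.2 • z.1.1, z.1.2)) := by fun_prop
      exact hmeas.stronglyMeasurable.integral_prod_right'.measurable
    obtain ⟨u, hu⟩ := TopologicalSpace.exists_dense_seq (EuclideanSpace ℝ (Fin d))
    have hset : MeasurableSet {p : EuclideanSpace ℝ (Fin d) × Ξ |
        HasGradientAt (fun x => f (x, p.2)) (φ p) p.1} := by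
      have heq : ∀ (p : EuclideanSpace ℝ (Fin d) × Ξ) (k : ℕ),
          f (p.1 + u k, p.2) - f (p.1, p.2) =
            (f (p.1 + u k, p.2) - f (0, p.2)) - (f p - f (0, p.2)) := fun p k => by ring
      simp_rw [hasGradientAt_iff_forall_exists_nat (hJ _).locallyLipschitz.continuous hu,
        heq]
      have hshift : ∀ k, Measurable fun p : EuclideanSpace ℝ (Fin d) × Ξ =>
          f (p.1 + u k, p.2) - f (0, p.2) := fun k =>
        hsub.comp ((measurable_fst.add_const (u k)).prodMk measurable_snd)
      refine measurableSet_setOfPred.2 (.forall fun n => .exists fun m => .forall fun k =>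
        .imp measurable_const (measurableSet_setOfPred.1 (measurableSet_le ?_ measurable_const)))
      exact (((hshift k).sub hsub).sub (hm.inner measurable_const)).abs
    rw [Measure.ae_prod_iff_ae_ae hset, Measure.ae_ae_comm hset]
    exact Eventually.of_forall hae

end AlmostEverywhere

/-! ### Backpropagation as a chain rule along curves. -/

lemma locallyLipschitz_toLp {α ι : Type*} [PseudoEMetricSpace α] [Fintype ι] {f : α → ι → ℝ}
    (hf : ∀ i, LocallyLipschitz fun x => f x i) :
    LocallyLipschitz fun x => (WithLp.toLp 2 (f x) : EuclideanSpace ℝ ι) := by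
  have hpi : LocallyLipschitz f := by
    intro x
    choose K t ht hK using fun i => hf i x
    refine ⟨∑ i, K i, ⋂ i, t i, iInter_mem.2 ht, fun y hy z hz => edist_pi_le_iff.2 fun i => ?_⟩
    refine (hK i (mem_iInter.1 hy i) (mem_iInter.1 hz i)).trans ?_
    gcongr
    exact Finset.single_le_sum_of_canonicallyOrdered (Finset.mem_univ i)
  exact (PiLp.continuousLinearEquiv 2 ℝ fun _ : ι => ℝ).symm.lipschitz.locallyLipschitz.comp hpi

lemma hasDerivAt_toLp {ι : Type*} [Fintype ι] {f : ℝ → ι → ℝ} {f' : ι → ℝ} {t : ℝ}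
    (h : ∀ i, HasDerivAt (fun t => f t i) (f' i) t) :
    HasDerivAt (fun t => (WithLp.toLp 2 (f t) : EuclideanSpace ℝ ι)) (WithLp.toLp 2 f') t :=
  (PiLp.continuousLinearEquiv 2 ℝ fun _ : ι => ℝ).symm.hasFDerivAt.comp_hasDerivAt t
    (hasDerivAt_pi.2 h)

namespace CompGraph

variable {d : ℕ} (G : CompGraph d)

lemma value_of_lt (x : EuclideanSpace ℝ (Fin d)) {i : Fin G.q} (h : i.val < d) :
    G.value x i = x ⟨i.val, h⟩ := by
  rw [value, dif_pos h]

lemma value_of_le (x : EuclideanSpace ℝ (Fin d)) {i : Fin G.q} (h : d ≤ i.val) :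
    G.value x i = G.func i (G.args x i) := by
  rw [value, dif_neg h.not_gt]
  rfl

lemma adjoint_eq (δ : (k : Fin G.q) → EuclideanSpace ℝ (G.parents k) →
      EuclideanSpace ℝ (G.parents k)) (x : EuclideanSpace ℝ (Fin d)) (i : Fin G.q) :
    G.adjoint δ x i = (if i = G.out then 1 else 0) +
      ∑ k : Fin G.q, if h : d ≤ k.val ∧ i ∈ G.parents k then
        G.adjoint δ x k * δ k (G.args x k) ⟨i, h.2⟩ else 0 := by
  rw [adjoint]

/-- Reverse induction along the vertices. -/
lemma parents_induction {p : Fin G.q → Prop}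
    (h : ∀ i, (∀ k, i ∈ G.parents k → p k) → p i) (i : Fin G.q) : p i :=
  (wellFounded_gt (α := Fin G.q)).induction i fun i ih =>
    h i fun k hk => ih k (G.parents_lt k i hk)

lemma adjoint_congr {δ δ' : (k : Fin G.q) → EuclideanSpace ℝ (G.parents k) →
      EuclideanSpace ℝ (G.parents k)} {x x' : EuclideanSpace ℝ (Fin d)}
    (h : ∀ k, d ≤ k.val → δ k (G.args x k) = δ' k (G.args x' k)) (i : Fin G.q) :
    G.adjoint δ x i = G.adjoint δ' x' i := by
  induction i using G.parents_induction with
  | h i ih =>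
    rw [adjoint_eq, adjoint_eq]
    congr 1
    refine Finset.sum_congr rfl fun k _ => ?_
    split_ifs with hk
    · rw [ih k hk.2, h k hk.1]
    · rfl

/-- Backpropagation with prescribed derivative vectors `v k` at the vertices. -/
noncomputable def backprop (v : (k : Fin G.q) → EuclideanSpace ℝ (G.parents k)) : EuclideanSpace ℝ (Fin d) :=
  G.autograd (fun k _ => v k) 0

/-- Needed to push σ-compactness forward to the graph of `gradients`. -/
lemma continuous_backprop : Continuous G.backprop := by
  have h : ∀ i, Continuous fun v : (k : Fin G.q) → EuclideanSpace ℝ (G.parents k) =>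
      G.adjoint (fun k _ => v k) 0 i := by
    intro i
    induction i using G.parents_induction with
    | h i ih =>
      simp_rw [G.adjoint_eq _ _ i]
      refine continuous_const.add (continuous_finsetSum _ fun k _ => ?_)
      split_ifs with hk
      · have := ih k hk.2
        fun_prop
      · exact continuous_const
  exact (PiLp.continuous_toLp 2 _).comp (continuous_pi fun i => h _)

lemma autograd_eq_backprop (δ : (k : Fin G.q) → EuclideanSpace ℝ (G.parents k) →
      EuclideanSpace ℝ (G.parents k)) (x : EuclideanSpace ℝ (Fin d)) :
    G.autograd δ x = G.backprop fun k => δ k (G.args x k) := by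
  simp only [backprop, autograd]
  congr 1
  funext i
  exact G.adjoint_congr (δ' := fun k _ => δ k (G.args x k)) (fun k _ => rfl) _

/-- If the numbers `y i` satisfy the forward chain rule with derivative vectors `v k`, then
backpropagation computes the derivative of the output vertex. -/
lemma inner_backprop {v : (k : Fin G.q) → EuclideanSpace ℝ (G.parents k)} {y : Fin G.q → ℝ}
    {e : EuclideanSpace ℝ (Fin d)} (he : ∀ i (h : i.val < d), y i = e ⟨i.val, h⟩)
    (hy : ∀ k, d ≤ k.val → y k = ∑ j : G.parents k, v k j * y j) :
    inner ℝ e (G.backprop v) = y G.out := by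
  set w : Fin G.q → ℝ := G.adjoint (fun k _ => v k) 0 with hw
  -- Inserting the backward recursion for `w`, exchanging sums and using the forward recursion for
  -- `y` reproduces the sum over computation vertices. It cancels against `h2`, leaving only the
  -- inputs.
  have h1 : ∑ i, w i * y i = y G.out + ∑ k : Fin G.q, if d ≤ k.val then w k * y k else 0 := by
    calc ∑ i, w i * y i
        = ∑ i, ((if i = G.out then y i else 0) + ∑ k : Fin G.q,
            if h : d ≤ k.val ∧ i ∈ G.parents k then w k * (v k ⟨i, h.2⟩ * y i) else 0) := by
          refine Finset.sum_congr rfl fun i _ => ?_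
          rw [hw, adjoint_eq, add_mul, Finset.sum_mul]
          congr 1
          · simp
          · refine Finset.sum_congr rfl fun k _ => ?_
            split_ifs
            · ring
            · ring
      _ = _ := by
          rw [Finset.sum_add_distrib, Finset.sum_ite_eq' Finset.univ G.out,
            if_pos (Finset.mem_univ _), Finset.sum_comm]
          congr 1
          refine Finset.sum_congr rfl fun k _ => ?_
          split_ifs with hk
          · rw [hy k hk, Finset.mul_sum]
            have h := Finset.sum_coe_sort (G.parents k) fun i =>
              if h : i ∈ G.parents k then w k * (v k ⟨i, h⟩ * y i) else 0
            simp only [Finset.coe_mem, dif_pos, Subtype.coe_eta] at h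
            rw [h]
            simp only [hk, true_and]
            exact (Finset.sum_subset (Finset.subset_univ _) fun i _ hi => dif_neg hi).symm
          · simp [hk]
  have h2 : ∑ i : Fin G.q, w i * y i =
      (∑ i : Fin G.q, if i.val < d then w i * y i else 0) +
        ∑ k : Fin G.q, if d ≤ k.val then w k * y k else 0 := by
    rw [← Finset.sum_add_distrib]
    refine Finset.sum_congr rfl fun i _ => ?_
    by_cases h : i.val < d
    · simp [h, h.not_ge]
    · simp [h, not_lt.1 h]
  have h3 : (∑ i : Fin G.q, if i.val < d then w i * y i else 0) = inner ℝ e (G.backprop v) := by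
    rw [PiLp.inner_apply]
    refine (Fintype.sum_of_injective (Fin.castLE G.d_lt_q.le) (Fin.castLE_injective _) _ _
      (fun i hi => if_neg fun h => hi ⟨⟨i, h⟩, rfl⟩) fun i => ?_).symm
    rw [if_pos (by simp), he _ (by simp)]
    rfl
  linarith

variable {G}

lemma value_locallyLipschitz
    (hG : ∀ k : Fin G.q, d ≤ k.val → LocallyLipschitz (G.func k)) (i : Fin G.q) :
    LocallyLipschitz fun x => G.value x i := by
  induction i using (wellFounded_lt (α := Fin G.q)).induction with
  | h i ih =>
    rcases lt_or_ge i.val d with hi | hi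
    · simp_rw [G.value_of_lt _ hi]
      exact (EuclideanSpace.proj (𝕜 := ℝ) (⟨i.val, hi⟩ : Fin d)).lipschitz.locallyLipschitz
    · simp_rw [G.value_of_le _ hi]
      exact (hG i hi).comp (locallyLipschitz_toLp fun j => ih j.1 (G.parents_lt i j.1 j.2))

lemma args_locallyLipschitz
    (hG : ∀ k : Fin G.q, d ≤ k.val → LocallyLipschitz (G.func k)) (i : Fin G.q) :
    LocallyLipschitz fun x => G.args x i :=
  locallyLipschitz_toLp fun j => value_locallyLipschitz hG j.1

/-- The derivative vectors which autodiff may use at `x`. -/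
def gradients (D : (k : Fin G.q) → EuclideanSpace ℝ (G.parents k) →
    Set (EuclideanSpace ℝ (G.parents k))) (x : EuclideanSpace ℝ (Fin d)) :
    Set (EuclideanSpace ℝ (Fin d)) :=
  G.backprop '' {v | ∀ k, d ≤ k.val → v k ∈ D k (G.args x k)}

/-- The derivatives of the vertex values along a curve obey the forward chain rule with any
admissible vectors, outside one null set of times serving all choices. -/
theorem hasPathGradient_eval {D : (k : Fin G.q) → EuclideanSpace ℝ (G.parents k) →
      Set (EuclideanSpace ℝ (G.parents k))}
    (hD : ∀ k, d ≤ k.val → IsPotential (G.func k) (D k)) :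
    HasPathGradient G.eval (gradients D) := by
  have hG : ∀ k : Fin G.q, d ≤ k.val → LocallyLipschitz (G.func k) := fun k hk =>
    (hD k hk).hasPathGradient.locallyLipschitz
  refine ⟨value_locallyLipschitz hG _, ?_, fun a ha => ?_⟩
  -- The vectors at input vertices are unconstrained here; `S` is still closed, hence σ-compact, and
  -- its image under `backprop` is the required graph.
  · set S : Set (EuclideanSpace ℝ (Fin d) × ((k : Fin G.q) → EuclideanSpace ℝ (G.parents k))) :=
      {p | ∀ k, d ≤ k.val → p.2 k ∈ D k (G.args p.1 k)} with hS
    have hcl : IsClosed S := by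
      simp only [hS, ofPred_forall]
      refine isClosed_iInter fun k => isClosed_iInter fun hk => ?_
      have := (args_locallyLipschitz hG k).continuous
      have hcont : Continuous fun p : EuclideanSpace ℝ (Fin d) ×
          ((k : Fin G.q) → EuclideanSpace ℝ (G.parents k)) => (G.args p.1 k, p.2 k) :=
        (this.comp continuous_fst).prodMk ((continuous_apply k).comp continuous_snd)
      exact (hD k hk).conservative.isClosed_graph.preimage hcont
    have hσ : IsSigmaCompact S := isSigmaCompact_univ.of_isClosed_subset hcl (subset_univ _)
    convert hσ.image (f := fun p => (p.1, G.backprop p.2))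
      (continuous_fst.prodMk (G.continuous_backprop.comp continuous_snd)) using 1
    ext ⟨x, w⟩
    simp [gradients, hS]
  · have hargs : ∀ k, LocallyLipschitz fun t => G.args (a t) k := fun k =>
      (args_locallyLipschitz hG k).comp ha
    have hdiff : ∀ᵐ t, DifferentiableAt ℝ a t := ha.ae_differentiableAt
    have hchain : ∀ᵐ t, ∀ k, d ≤ k.val → ∀ v ∈ D k (G.args (a t) k),
        HasDerivAt (fun t => G.func k (G.args (a t) k))
          (inner ℝ (deriv (fun t => G.args (a t) k) t) v) t :=
      ae_all_iff.2 fun k => by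
        by_cases hk : d ≤ k.val
        · filter_upwards [(hD k hk).ae_hasDerivAt (hargs k)] with t ht _ using ht
        · exact Eventually.of_forall fun t h => absurd h hk
    filter_upwards [hdiff, hchain] with t hat hct
    rintro _ ⟨v, hv, rfl⟩
    have hval : ∀ i, DifferentiableAt ℝ (fun t => G.value (a t) i) t := by
      intro i
      rcases lt_or_ge i.val d with hi | hi
      · simp_rw [G.value_of_lt _ hi]
        fun_prop
      · simp_rw [G.value_of_le _ hi]
        exact (hct i hi _ (hv i hi)).differentiableAt
    have hdargs : ∀ k, HasDerivAt (fun t => G.args (a t) k)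
        (WithLp.toLp 2 fun j : G.parents k => deriv (fun t => G.value (a t) j) t) t := fun k =>
      hasDerivAt_toLp fun j => (hval j).hasDerivAt
    rw [G.inner_backprop (y := fun i => deriv (fun t => G.value (a t) i) t)]
    · exact (hval _).hasDerivAt
    · intro i hi
      simp_rw [G.value_of_lt _ hi]
      exact ((EuclideanSpace.proj (𝕜 := ℝ) (⟨i.val, hi⟩ : Fin d)).hasFDerivAt.comp_hasDerivAt t
        hat.hasDerivAt).deriv
    · intro k hk
      simp_rw [G.value_of_le _ hk]
      rw [(hct k hk _ (hv k hk)).deriv, (hdargs k).deriv]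
      simp [PiLp.inner_apply]

end CompGraph

theorem mainTheorem12 {d : ℕ} {Ξ : Type*} [MeasurableSpace Ξ] (μ : Measure Ξ)
    [IsProbabilityMeasure μ] :
    -- measurable selections of conservative fields
    (∀ (f : EuclideanSpace ℝ (Fin d) × Ξ → ℝ)
      (D : Ξ → EuclideanSpace ℝ (Fin d) → Set (EuclideanSpace ℝ (Fin d)))
      (φ : EuclideanSpace ℝ (Fin d) × Ξ → EuclideanSpace ℝ (Fin d)),
      (∀ s, IsPotential (fun x => f (x, s)) (D s)) →
      Measurable φ →
      (∀ x s, φ (x, s) ∈ D s x) →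
      IsAEGradient μ f φ) ∧
    -- automatic differentiation
    (∀ (G : Ξ → CompGraph d)
      (δ : (s : Ξ) → (k : Fin (G s).q) →
        EuclideanSpace ℝ ((G s).parents k) → EuclideanSpace ℝ ((G s).parents k)),
      (∀ s, (G s).IsOracle (δ s)) →
      (Countable Ξ ∨
        Measurable fun p : EuclideanSpace ℝ (Fin d) × Ξ => (G p.2).autograd (δ p.2) p.1) →
      IsAEGradient μ (fun p => (G p.2).eval p.1) (fun p => (G p.2).autograd (δ p.2) p.1)) := by
  refine ⟨fun f D φ hf hφm hφ =>
    isAEGradient_of_hasPathGradient (fun s => (hf s).hasPathGradient) hφ (Or.inr hφm),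
    fun G δ hδ hm => ?_⟩
  have hD : ∀ s, ∃ D : (k : Fin (G s).q) → EuclideanSpace ℝ ((G s).parents k) →
      Set (EuclideanSpace ℝ ((G s).parents k)), ∀ k, d ≤ k.val →
        IsPotential ((G s).func k) (D k) ∧ ∀ z, δ s k z ∈ D k z := fun s => by
    have : ∀ k : Fin (G s).q, ∃ D, d ≤ k.val →
        IsPotential ((G s).func k) D ∧ ∀ z, δ s k z ∈ D z := fun k => by
      by_cases hk : d ≤ k.val
      · obtain ⟨D, hD⟩ := hδ s k hk
        exact ⟨D, fun _ => hD⟩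
      · exact ⟨fun _ => ∅, fun h => absurd h hk⟩
    exact ⟨fun k => (this k).choose, fun k => (this k).choose_spec⟩
  choose D hD using hD
  refine isAEGradient_of_hasPathGradient (J := fun s => CompGraph.gradients (D s))
    (fun s => CompGraph.hasPathGradient_eval fun k hk => (hD s k hk).1) (fun x s => ?_) hm
  rw [CompGraph.autograd_eq_backprop]
  exact mem_image_of_mem _ fun k hk => (hD s k hk).2 _
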